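/- Let $\mathbb T=\{z\in\mathbb C:|z|=1\}$ and, for $f\in L^1(\mathbb T)$, let $[f]_n=f_n=\frac1{2\pi}\int_0^{2\pi}f(e^{i\theta})e^{-in\theta}\,d\theta$, $n\in\mathbb Z$. Let $T_N(f)=(f_{j-k})_{0\le j,k\le N-1}$ be the $N\times N$ Toeplitz matrix of $f$ and $T(f)=(f_{j-k})_{0\le j,k<\infty}$ the infinite Toeplitz matrix, which is a bounded operator on $\ell^2=\ell^2(\{0,1,2,\dots\})$ when $f\in C(\mathbb T)$. Let $e_0=(1,0,0,\dots)^T$, either in $\mathbb C^N$ or in $\ell^2$; for $f\in L^2(\mathbb T)$, $T(f)e_0=(f_0,f_1,f_2,\dots)^T\in\ell^2$. Let $H^\infty_+$ (respectively $H^\infty_-$) be the set of $f\in L^\infty(\mathbb T)$ with $f_n=0$ for all $n<0$ (respectively for all $n>0$). A continuous canonical Wiener–Hopf factorization of $\phi\in C(\mathbb T)$ is a representation $\phi=\phi_-\phi_+$ on $\mathbb T$ in which $\phi_\pm$ are nonvanishing and $\phi_+,\phi_+^{-1}\in H^\infty_+\cap C(\mathbb T)$, $\phi_-,\phi_-^{-1}\in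 H^\infty_-\cap C(\mathbb T)$. **Proposition 3.2.** Let $\psi\in L^2(\mathbb T)$, and let $\phi\in C(\mathbb T)$ be nonvanishing on $\mathbb T$ with winding number zero (about the origin). Then $T(\phi)$ is invertible on $\ell^2$, $T_N(\phi)$ is invertible for all sufficiently large $N$, and $$F_N[\phi;\psi]:=e_0^T\,T_N^{-1}(\phi)\,T_N(\psi)\,e_0\;\longrightarrow\;F[\phi;\psi]:=e_0^T\,T^{-1}(\phi)\,T(\psi)\,e_0\qquad(N\to\infty).$$ If, in addition, $\phi$ has a continuous canonical Wiener–Hopf factorization $\phi=\phi_-\phi_+$, then, for any such factorization, $[\phi_+]_0\neq0$ and $$F[\phi;\psi]=\frac{[\phi_-^{-1}\psi]_0}{[\phi_+]_0}.$$ -/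

import Mathlib

open MeasureTheory Filter Topology
open scoped ENNReal

noncomputable section

namespace BorderedToeplitz

instance instFactTwoPi : Fact ((0 : ℝ) < 2 * Real.pi) := ⟨Real.two_pi_pos⟩

/-- The unit circle `{z : |z| = 1}`, parametrized by `z = e^{iθ}` with `θ` taken modulo `2π`. -/
abbrev Torus : Type := AddCircle (2 * Real.pi)

/-- Normalized arc length `dθ / 2π` on the unit circle. -/
abbrev arcMeasure : Measure Torus := AddCircle.haarAddCircle

/-- The Hilbert space `L²(𝕋)` with respect to `dθ / 2π`. -/
abbrev LTwo : Type := Lp ℂ 2 arcMeasure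

/-- The Hilbert space `ℓ²` of square summable complex sequences `(x₀, x₁, x₂, …)`. -/
abbrev EllTwo : Type := lp (fun _ : ℕ => ℂ) 2

/-- The Fourier coefficient `[f]_n = (1 / 2π) ∫₀^{2π} f(e^{iθ}) e^{-inθ} dθ`. -/
def coeff (f : Torus → ℂ) (n : ℤ) : ℂ := fourierCoeff f n

theorem coeff_eq_integral (f : Torus → ℂ) (n : ℤ) :
    coeff f n = (1 / (2 * Real.pi) : ℝ) *
      ∫ θ in (0 : ℝ)..(2 * Real.pi), f (θ : Torus) * Complex.exp (-(Complex.I * n * θ)) := by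
  unfold coeff
  rw [fourierCoeff_eq_intervalIntegral f n 0, zero_add, Complex.real_smul]
  congr 1
  refine intervalIntegral.integral_congr fun θ _ => ?_
  simp only [smul_eq_mul]
  rw [fourier_coe_apply, mul_comm]
  congr 2
  have : (Real.pi : ℂ) ≠ 0 := by exact_mod_cast Real.pi_ne_zero
  push_cast
  field_simp

/-- The continuous function `φ` on the circle has winding number `n` about the origin: a
continuous argument `α` of `φ(e^{iθ})`, `0 ≤ θ ≤ 2π`, increases by `2πn`. -/
def HasWindingNumber (φ : C(Torus, ℂ)) (n : ℤ) : Prop :=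
  ∃ α : ℝ → ℝ, ContinuousOn α (Set.Icc 0 (2 * Real.pi)) ∧
    (∀ θ ∈ Set.Icc (0 : ℝ) (2 * Real.pi),
      φ (θ : Torus) = (‖φ (θ : Torus)‖ : ℂ) * Complex.exp ((α θ : ℂ) * Complex.I)) ∧
    α (2 * Real.pi) - α 0 = 2 * Real.pi * n

/-- The Hardy space `H^∞_+`. -/
def IsHardyPlus (f : Torus → ℂ) : Prop :=
  MemLp f ∞ arcMeasure ∧ ∀ n : ℤ, n < 0 → coeff f n = 0

/-- The Hardy space `H^∞_-`. -/
def IsHardyMinus (f : Torus → ℂ) : Prop :=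
  MemLp f ∞ arcMeasure ∧ ∀ n : ℤ, 0 < n → coeff f n = 0

/-- `φ = φm φp` is a continuous canonical Wiener-Hopf factorization: `φp`, `φp⁻¹` are continuous
and lie in `H^∞_+`, and `φm`, `φm⁻¹` are continuous and lie in `H^∞_-`. -/
structure IsWienerHopf (φ φm φp : C(Torus, ℂ)) : Prop where
  factor : ∀ t, φ t = φm t * φp t
  minus_ne_zero : ∀ t, φm t ≠ 0
  plus_ne_zero : ∀ t, φp t ≠ 0
  minus_mem : IsHardyMinus φm
  minus_inv_mem : IsHardyMinus (fun t => (φm t)⁻¹)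
  plus_mem : IsHardyPlus φp
  plus_inv_mem : IsHardyPlus (fun t => (φp t)⁻¹)

/-- The infinite Toeplitz matrix `(f_{j-k})`, `0 ≤ j, k < ∞`. -/
def infMatrix (f : Torus → ℂ) : Matrix ℕ ℕ ℂ :=
  Matrix.of fun j k => coeff f ((j : ℤ) - (k : ℤ))

/-- The `N × N` Toeplitz matrix `T_N(f) = (f_{j-k})`, `0 ≤ j, k < N`. -/
def finMatrix (N : ℕ) (f : Torus → ℂ) : Matrix (Fin N) (Fin N) ℂ :=
  Matrix.of fun j k => coeff f ((j : ℤ) - (k : ℤ))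

/-- The vector `e₀ = (1, 0, …, 0)ᵀ` in `ℂᴺ`. -/
def eZero (N : ℕ) : Fin N → ℂ := fun i => if (i : ℕ) = 0 then 1 else 0

/-- `F_N[φ; ψ] = e₀ᵀ T_N(φ)⁻¹ T_N(ψ) e₀`. -/
def finConst (N : ℕ) (φ ψ : Torus → ℂ) : ℂ :=
  eZero N ⬝ᵥ ((finMatrix N φ)⁻¹.mulVec ((finMatrix N ψ).mulVec (eZero N)))

/-- The isometry from `ℓ²` to `L²(𝕋)` that sends `(x₀, x₁, …)` to `∑ xₖ zᵏ`. -/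
def synth : EllTwo →ₗᵢ[ℂ] LTwo :=
  ((orthonormal_fourier (T := 2 * Real.pi)).comp (fun k : ℕ => (k : ℤ))
    Nat.cast_injective).orthogonalFamily.linearIsometry

/-- Multiplication by the continuous function `φ` on `L²(𝕋)`. -/
def mulOp (φ : C(Torus, ℂ)) : LTwo →L[ℂ] LTwo :=
  (ContinuousLinearMap.mul ℂ ℂ).holderL arcMeasure ∞ 2 2
    (ContinuousMap.toLp (E := ℂ) ∞ arcMeasure ℂ φ)

/-- The Toeplitz operator `T(φ)` on `ℓ²`, the bounded operator with matrix `(φ_{j-k})` (see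
`toepOp_hasSum` below), realized as the compression of multiplication by `φ` to the span of
`1, z, z², …`. -/
def toepOp (φ : C(Torus, ℂ)) : EllTwo →L[ℂ] EllTwo :=
  (ContinuousLinearMap.adjoint synth.toContinuousLinearMap).comp
    ((mulOp φ).comp synth.toContinuousLinearMap)

theorem mulOp_coeFn (φ : C(Torus, ℂ)) (f : LTwo) :
    mulOp φ f =ᵐ[arcMeasure] fun t => φ t * f t := by
  have h1 := (ContinuousLinearMap.mul ℂ ℂ).coeFn_holder (r := 2)
    (ContinuousMap.toLp (E := ℂ) ∞ arcMeasure ℂ φ) f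
  have h2 := ContinuousMap.coeFn_toLp (E := ℂ) (p := ∞) (𝕜 := ℂ) arcMeasure φ
  have h3 : mulOp φ f = (ContinuousLinearMap.mul ℂ ℂ).holder 2
    (ContinuousMap.toLp (E := ℂ) ∞ arcMeasure ℂ φ) f := rfl
  rw [h3]
  filter_upwards [h1, h2] with t ht1 ht2
  rw [ht1, ht2]
  rfl

theorem synth_single (k : ℕ) (c : ℂ) :
    synth (lp.single 2 k c) = c • fourierLp (T := 2 * Real.pi) 2 (k : ℤ) := by
  unfold synth
  rw [OrthogonalFamily.linearIsometry_apply_single]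
  rfl

theorem toepOp_single_apply (φ : C(Torus, ℂ)) (j k : ℕ) :
    toepOp φ (lp.single 2 k 1) j = infMatrix φ j k := by
  have h1 : toepOp φ (lp.single 2 k 1) j
      = inner ℂ (lp.single 2 j (1 : ℂ) : EllTwo) (toepOp φ (lp.single 2 k 1)) := by
    rw [lp.inner_single_left]
    simp
  rw [h1]
  unfold toepOp
  rw [ContinuousLinearMap.comp_apply, ContinuousLinearMap.adjoint_inner_right]
  simp only [ContinuousLinearMap.comp_apply, LinearIsometry.coe_toContinuousLinearMap,
    synth_single, one_smul]
  rw [L2.inner_def]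
  simp only [infMatrix, Matrix.of_apply, coeff, fourierCoeff]
  refine integral_congr_ae ?_
  filter_upwards [mulOp_coeFn φ (fourierLp 2 (k : ℤ)),
    coeFn_fourierLp (T := 2 * Real.pi) 2 (k : ℤ),
    coeFn_fourierLp (T := 2 * Real.pi) 2 (j : ℤ)] with t h2 h3 h4
  rw [h2, h3, h4, RCLike.inner_apply, ← fourier_neg, smul_eq_mul]
  rw [show -((j : ℤ) - (k : ℤ)) = (k : ℤ) + -(j : ℤ) by ring, fourier_add]
  ring

/-- `T(φ)` acts on `ℓ²` by the infinite matrix `(φ_{j-k})`. -/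
theorem toepOp_hasSum (φ : C(Torus, ℂ)) (x : EllTwo) (j : ℕ) :
    HasSum (fun k : ℕ => infMatrix φ j k * x k) (toepOp φ x j) := by
  have h1 := lp.hasSum_single (p := 2) (by simp) x
  have h2 := (toepOp φ).hasSum h1
  have h3 := (innerSL ℂ (lp.single 2 j (1 : ℂ) : EllTwo)).hasSum h2
  have key : ∀ y : EllTwo, innerSL ℂ (lp.single 2 j (1 : ℂ) : EllTwo) y = y j := fun y => by
    rw [innerSL_apply_apply, lp.inner_single_left]
    simp
  rw [key] at h3
  have h4 : ∀ k : ℕ, innerSL ℂ (lp.single 2 j (1 : ℂ) : EllTwo) (toepOp φ (lp.single 2 k (x k)))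
      = infMatrix φ j k * x k := fun k => by
    have : (lp.single 2 k (x k) : EllTwo) = x k • lp.single 2 k (1 : ℂ) := by
      rw [← lp.single_smul]
      simp
    rw [key, this, map_smul, lp.coeFn_smul, Pi.smul_apply, toepOp_single_apply, smul_eq_mul,
      mul_comm]
  simpa only [h4] using h3

/-- The vector `T(ψ) e₀` in `ℓ²`, for `ψ` in `L²(𝕋)`: the first column `(ψ₀, ψ₁, ψ₂, …)ᵀ` of the
infinite Toeplitz matrix of `ψ`. -/
def toepCol (ψ : LTwo) : EllTwo :=
  ⟨fun j => infMatrix ψ j 0, by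
    refine memℓp_gen ?_
    have h := (hasSum_sq_fourierCoeff ψ).summable.comp_injective
      (Nat.cast_injective : Function.Injective (fun k : ℕ => (k : ℤ)))
    simpa [infMatrix, coeff, Function.comp_def] using h⟩

/-- `F[φ; ψ] = e₀ᵀ T(φ)⁻¹ T(ψ) e₀`, where `e₀ᵀ` takes the coordinate with index `0`. The inverse
is the one in the algebra of bounded operators on `ℓ²`; it is meaningful when `T(φ)` is
invertible there. -/
def limConst (φ : C(Torus, ℂ)) (ψ : LTwo) : ℂ :=
  (Ring.inverse (toepOp φ) (toepCol ψ) : EllTwo) 0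

end BorderedToeplitz

end

open MeasureTheory Filter Topology
open scoped ENNReal

noncomputable section

namespace BorderedToeplitz

/-! Winding number zero gives a continuous logarithm, `φ = exp b`. For a trigonometric polynomial `p
= a + c` near `b`, with `a` analytic outside and `c` inside the disc, `φ = exp a * exp (b - p) * exp
c`. The Toeplitz operators of the three factors multiply, the outer two are invertible, and the
middle one is close to the identity; hence `isUnit_toepOp_exp`.

The core is stability of the finite sections, `exists_norm_trunc_sq_le`: for large `N` the section
is bounded below uniformly in `N`. Away from both ends of `{0, …, N-1}`, a banded approximate
inverse of `φ` controls the entries; near 0 the rows of `T(φ)⁻¹` do; near `N-1`, reversing the order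
turns the section into that of `φ(z⁻¹)`, again an exponential. Stability makes the sections
invertible and bounds the distance from the finite solution to the truncated infinite one by the
tail of the latter.

For a Wiener–Hopf factorization, `T(φ) = T(φ₋)T(φ₊)`, so `X = T(φ)⁻¹T(ψ)e₀` satisfies `T(φ₊)X =
T(φ₋⁻¹)T(ψ)e₀`; coordinate 0 of this identity is the formula. -/

/-! ### Fourier coordinates and multiplication operators on `L²`. -/

/-- The `n`-th Fourier coefficient as a bounded functional on `L²(𝕋)`. -/
def coord (n : ℤ) : LTwo →L[ℂ] ℂ := innerSL ℂ (fourierLp (T := 2 * Real.pi) 2 n)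

theorem coord_apply (n : ℤ) (x : LTwo) :
    coord n x = inner ℂ (fourierLp (T := 2 * Real.pi) 2 n) x := rfl

theorem coord_eq_coeff (n : ℤ) (x : LTwo) : coord n x = coeff x n := by
  rw [coord_apply, coeff, ← fourierBasis_repr, HilbertBasis.repr_apply_apply, coe_fourierBasis]

theorem hasSum_coord (x : LTwo) :
    HasSum (fun n : ℤ => coord n x • fourierLp (T := 2 * Real.pi) 2 n) x := by
  have h := (fourierBasis (T := 2 * Real.pi)).hasSum_repr x
  simp only [HilbertBasis.repr_apply_apply, coe_fourierBasis] at h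
  exact h

theorem ext_coord {x y : LTwo} (h : ∀ n, coord n x = coord n y) : x = y := by
  have hx := hasSum_coord x
  simp only [h] at hx
  exact hx.unique (hasSum_coord y)

theorem coeff_congr {f g : Torus → ℂ} (h : f =ᵐ[arcMeasure] g) (n : ℤ) :
    coeff f n = coeff g n := by
  unfold coeff fourierCoeff
  refine integral_congr_ae ?_
  filter_upwards [h] with t ht
  rw [ht]

theorem coord_mulOp (φ : C(Torus, ℂ)) (n : ℤ) (x : LTwo) :
    coord n (mulOp φ x) = coeff (fun t => φ t * x t) n := by
  rw [coord_eq_coeff]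
  exact coeff_congr (mulOp_coeFn φ x) n

theorem coord_mulOp_fourierLp (φ : C(Torus, ℂ)) (n k : ℤ) :
    coord n (mulOp φ (fourierLp (T := 2 * Real.pi) 2 k)) = coeff φ (n - k) := by
  rw [coord_mulOp]
  unfold coeff fourierCoeff
  refine integral_congr_ae ?_
  filter_upwards [coeFn_fourierLp (T := 2 * Real.pi) 2 k] with t ht
  rw [ht, neg_sub, sub_eq_add_neg, fourier_add, smul_eq_mul, smul_eq_mul]
  ring

theorem coord_mulOp_fourier (k n : ℤ) (x : LTwo) :
    coord n (mulOp (fourier k) x) = coord (n - k) x := by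
  rw [coord_mulOp, coord_eq_coeff]
  unfold coeff fourierCoeff
  refine integral_congr_ae (Eventually.of_forall fun t => ?_)
  simp only [smul_eq_mul]
  rw [neg_sub, sub_eq_add_neg, fourier_add]
  ring

theorem coord_fourierLp (n k : ℤ) :
    coord n (fourierLp (T := 2 * Real.pi) 2 k) = if n = k then 1 else 0 :=
  orthonormal_iff_ite.mp orthonormal_fourier n k

/-- Multiplication operators depend linearly and boundedly on their symbol. -/
def mulOpL : C(Torus, ℂ) →L[ℂ] LTwo →L[ℂ] LTwo :=
  ((ContinuousLinearMap.mul ℂ ℂ).holderL arcMeasure ∞ 2 2).comp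
    (ContinuousMap.toLp (E := ℂ) ∞ arcMeasure ℂ)

theorem mulOpL_apply (φ : C(Torus, ℂ)) : mulOpL φ = mulOp φ := rfl

theorem mulOp_mul (f g : C(Torus, ℂ)) : mulOp (f * g) = (mulOp f).comp (mulOp g) := by
  ext1 x
  apply Lp.ext
  filter_upwards [mulOp_coeFn (f * g) x, mulOp_coeFn g x, mulOp_coeFn f (mulOp g x)] with t h1 h2 h3
  rw [ContinuousLinearMap.comp_apply, h1, h3, h2, ContinuousMap.mul_apply, mul_assoc]

theorem mulOp_one : mulOp 1 = ContinuousLinearMap.id ℂ LTwo := by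
  ext1 x
  apply Lp.ext
  filter_upwards [mulOp_coeFn 1 x] with t h1
  rw [h1, ContinuousMap.one_apply, one_mul, ContinuousLinearMap.id_apply]

theorem hasSum_coord_mulOp (f : C(Torus, ℂ)) (n : ℤ) (x : LTwo) :
    HasSum (fun k : ℤ => coord k x * coeff f (n - k)) (coord n (mulOp f x)) := by
  have h := ((coord n).comp (mulOp f)).hasSum (hasSum_coord x)
  simpa only [map_smul, ContinuousLinearMap.comp_apply, coord_mulOp_fourierLp, smul_eq_mul]
    using h

/-! ### Closed algebras of one-sided symbols. -/

/-- The symbols whose multiplication operators preserve the space of all `x ∈ L²(𝕋)` with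
`xₙ = 0` for `n ∈ S`. -/
def stabilizer (S : Set ℤ) : Subalgebra ℂ C(Torus, ℂ) where
  carrier := {f | ∀ x, (∀ n ∈ S, coord n x = 0) → ∀ n ∈ S, coord n (mulOp f x) = 0}
  mul_mem' {f g} hf hg x hx n hn := by
    rw [mulOp_mul]
    exact hf _ (hg x hx) n hn
  add_mem' {f g} hf hg x hx n hn := by
    rw [← mulOpL_apply, map_add, add_apply, map_add, mulOpL_apply,
      mulOpL_apply, hf x hx n hn, hg x hx n hn, add_zero]
  algebraMap_mem' c x hx n hn := by
    rw [Algebra.algebraMap_eq_smul_one, ← mulOpL_apply, map_smul, mulOpL_apply, mulOp_one,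
      smul_apply, map_smul, ContinuousLinearMap.id_apply, hx n hn, smul_zero]

theorem mem_stabilizer {S : Set ℤ} {f : C(Torus, ℂ)} : f ∈ stabilizer S ↔
    ∀ x, (∀ n ∈ S, coord n x = 0) → ∀ n ∈ S, coord n (mulOp f x) = 0 := Iff.rfl

theorem isClosed_stabilizer (S : Set ℤ) : IsClosed (stabilizer S : Set C(Torus, ℂ)) := by
  have h : (stabilizer S : Set C(Torus, ℂ)) = ⋂ (x : LTwo) (_ : ∀ n ∈ S, coord n x = 0)
      (n : ℤ) (_ : n ∈ S), {f | coord n (mulOpL f x) = 0} := by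
    ext f
    simp only [SetLike.mem_coe, mem_stabilizer, Set.mem_iInter, Set.mem_ofPred_eq, mulOpL_apply]
  rw [h]
  refine isClosed_iInter fun x => isClosed_iInter fun _ => isClosed_iInter fun n =>
    isClosed_iInter fun _ => isClosed_eq ?_ continuous_const
  fun_prop

/-- The hypothesis kills every matrix entry of multiplication by `f` leading from an index outside
`S` to one in `S`. -/
theorem mem_stabilizer_of_coeff {S : Set ℤ} {f : C(Torus, ℂ)}
    (h : ∀ n ∈ S, ∀ k ∉ S, coeff f (n - k) = 0) : f ∈ stabilizer S := by
  intro x hx n hn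
  have h0 : (fun k : ℤ => coord k x * coeff f (n - k)) = fun _ => 0 := by
    ext k
    by_cases hk : k ∈ S
    · rw [hx k hk, zero_mul]
    · rw [h n hn k hk, mul_zero]
  have h1 := hasSum_coord_mulOp f n x
  rw [h0] at h1
  exact h1.unique hasSum_zero

theorem fourier_mem_stabilizer {S : Set ℤ} {k : ℤ} (h : ∀ n ∈ S, n - k ∈ S) :
    fourier k ∈ stabilizer S := by
  intro x hx n hn
  rw [coord_mulOp_fourier]
  exact hx _ (h n hn)

/-- The symbols that leave the Hardy space `H²` invariant. -/
abbrev plusAlgebra : Subalgebra ℂ C(Torus, ℂ) := stabilizer {n | n < 0}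

/-- The symbols that leave the orthogonal complement of `H²` invariant. -/
abbrev minusAlgebra : Subalgebra ℂ C(Torus, ℂ) := stabilizer {n | 0 ≤ n}

/-! ### Toeplitz operators as compressions. -/

theorem coord_synth (n : ℤ) (x : EllTwo) :
    coord n (synth x) = if 0 ≤ n then x n.toNat else 0 := by
  have h1 := (coord n).hasSum
    (synth.toContinuousLinearMap.hasSum (lp.hasSum_single (p := 2) (by simp) x))
  simp only [LinearIsometry.coe_toContinuousLinearMap, synth_single, map_smul, coord_fourierLp,
    smul_eq_mul] at h1
  refine h1.unique ?_
  split_ifs with hn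
  · convert hasSum_ite_eq n.toNat (x n.toNat) using 2 with k
    rcases eq_or_ne k n.toNat with rfl | hk
    · simp [hn]
    · rw [if_neg hk, if_neg (by omega), mul_zero]
  · convert hasSum_zero using 2 with k
    rw [if_neg (by omega), mul_zero]

theorem coord_synth_nat (n : ℕ) (x : EllTwo) : coord n (synth x) = x n := by
  simp [coord_synth]

theorem adjoint_synth_apply (y : LTwo) (n : ℕ) :
    (ContinuousLinearMap.adjoint synth.toContinuousLinearMap y : EllTwo) n = coord n y := by
  have h := ContinuousLinearMap.adjoint_inner_right synth.toContinuousLinearMap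
    (lp.single 2 n (1 : ℂ) : EllTwo) y
  rw [lp.inner_single_left] at h
  simpa [synth_single, coord_apply] using h

theorem toepOp_apply (f : C(Torus, ℂ)) (x : EllTwo) (n : ℕ) :
    toepOp f x n = coord n (mulOp f (synth x)) := by
  rw [← adjoint_synth_apply]
  rfl

theorem coord_synth_adjoint (y : LTwo) {n : ℤ} (hn : 0 ≤ n) :
    coord n (synth (ContinuousLinearMap.adjoint synth.toContinuousLinearMap y)) = coord n y := by
  lift n to ℕ using hn
  rw [coord_synth_nat, adjoint_synth_apply]

theorem synth_adjoint_of_coord {y : LTwo} (hy : ∀ n : ℤ, n < 0 → coord n y = 0) :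
    synth (ContinuousLinearMap.adjoint synth.toContinuousLinearMap y) = y := by
  refine ext_coord fun n => ?_
  rcases lt_or_ge n 0 with hn | hn
  · rw [hy n hn, coord_synth, if_neg (by omega)]
  · exact coord_synth_adjoint y hn

theorem adjoint_mulOp_synth_adjoint {f : C(Torus, ℂ)} (hf : f ∈ minusAlgebra) (y : LTwo)
    {n : ℤ} (hn : 0 ≤ n) :
    coord n (mulOp f (synth (ContinuousLinearMap.adjoint synth.toContinuousLinearMap y)))
      = coord n (mulOp f y) := by
  rw [← sub_eq_zero, ← map_sub, ← map_sub]
  refine hf _ (fun k hk => ?_) n hn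
  rw [map_sub, coord_synth_adjoint y hk, sub_self]

/-- The part of `g * x` lost in the inner projection has only negative frequencies; `f` keeps them
negative, so the outer projection would remove it anyway. -/
theorem toepOp_mul_of_minus {f : C(Torus, ℂ)} (hf : f ∈ minusAlgebra) (g : C(Torus, ℂ)) :
    toepOp (f * g) = toepOp f * toepOp g := by
  ext x n
  rw [toepOp_apply, mul_apply_eq_comp, toepOp_apply, mulOp_mul]
  exact (adjoint_mulOp_synth_adjoint hf _ (by positivity)).symm

/-- Here `g * x` already lies in `H²`, so the inner projection does nothing. -/
theorem toepOp_mul_of_plus (f : C(Torus, ℂ)) {g : C(Torus, ℂ)} (hg : g ∈ plusAlgebra) :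
    toepOp (f * g) = toepOp f * toepOp g := by
  ext x n
  rw [toepOp_apply, mul_apply_eq_comp, toepOp_apply, mulOp_mul]
  have h : synth (toepOp g x) = mulOp g (synth x) := by
    refine synth_adjoint_of_coord fun n hn => hg _ (fun k hk => ?_) n hn
    change coord k (synth x) = 0
    rw [coord_synth, if_neg (by simpa using hk)]
  rw [h, ContinuousLinearMap.comp_apply]

theorem toepOp_one : toepOp 1 = 1 := by
  ext x n
  rw [toepOp_apply, mulOp_one, ContinuousLinearMap.id_apply, coord_synth_nat,
    one_apply_eq_self]

theorem continuous_toepOp : Continuous toepOp := by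
  have h : toepOp = fun f => (ContinuousLinearMap.adjoint synth.toContinuousLinearMap).comp
    ((mulOpL f).comp synth.toContinuousLinearMap) := rfl
  rw [h]
  fun_prop

theorem isUnit_toepOp_of_minus {f g : C(Torus, ℂ)} (hf : f ∈ minusAlgebra)
    (hg : g ∈ minusAlgebra) (h : f * g = 1) : IsUnit (toepOp f) :=
  ⟨⟨toepOp f, toepOp g, by rw [← toepOp_mul_of_minus hf, h, toepOp_one],
    by rw [← toepOp_mul_of_minus hg, mul_comm, h, toepOp_one]⟩, rfl⟩

theorem isUnit_toepOp_of_plus {f g : C(Torus, ℂ)} (hf : f ∈ plusAlgebra)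
    (hg : g ∈ plusAlgebra) (h : f * g = 1) : IsUnit (toepOp f) :=
  ⟨⟨toepOp f, toepOp g, by rw [← toepOp_mul_of_plus _ hg, h, toepOp_one],
    by rw [← toepOp_mul_of_plus _ hf, mul_comm, h, toepOp_one]⟩, rfl⟩

/-! ### Invertibility of `T(exp b)` and the continuous logarithm. -/

theorem exists_minus_add_plus {p : C(Torus, ℂ)}
    (hp : p ∈ Submodule.span ℂ (Set.range (fourier (T := 2 * Real.pi)))) :
    ∃ a ∈ minusAlgebra, ∃ c ∈ plusAlgebra, p = a + c := by
  induction hp using Submodule.span_induction with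
  | mem x hx =>
    obtain ⟨k, rfl⟩ := hx
    rcases le_total k 0 with hk | hk
    · exact ⟨_, fourier_mem_stabilizer (k := k) fun n hn => by
        simp only [Set.mem_ofPred_eq] at *; omega, 0, zero_mem _, (add_zero _).symm⟩
    · exact ⟨0, zero_mem _, _, fourier_mem_stabilizer (k := k) fun n hn => by
        simp only [Set.mem_ofPred_eq] at *; omega, (zero_add _).symm⟩
  | zero => exact ⟨0, zero_mem _, 0, zero_mem _, (add_zero _).symm⟩
  | add x y _ _ hx hy =>
    obtain ⟨a, ha, c, hc, rfl⟩ := hx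
    obtain ⟨a', ha', c', hc', rfl⟩ := hy
    exact ⟨a + a', add_mem ha ha', c + c', add_mem hc hc', by ring⟩
  | smul r x _ hx =>
    obtain ⟨a, ha, c, hc, rfl⟩ := hx
    exact ⟨r • a, Subalgebra.smul_mem _ ha r, r • c, Subalgebra.smul_mem _ hc r, smul_add r a c⟩

theorem exp_mem_stabilizer {S : Set ℤ} {f : C(Torus, ℂ)} (hf : f ∈ stabilizer S) :
    NormedSpace.exp f ∈ stabilizer S :=
  NormedSpace.exp_mem (R := ℂ) (isClosed_stabilizer S) hf

theorem exp_mul_exp_neg (f : C(Torus, ℂ)) : NormedSpace.exp f * NormedSpace.exp (-f) = 1 := by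
  rw [← NormedSpace.exp_add_of_commute (Commute.all f (-f)), add_neg_cancel, NormedSpace.exp_zero]

theorem dense_span_fourier :
    Dense (Submodule.span ℂ (Set.range (fourier (T := 2 * Real.pi))) : Set C(Torus, ℂ)) := by
  rw [Submodule.dense_iff_topologicalClosure_eq_top]
  exact span_fourier_closure_eq_top

theorem isUnit_toepOp_exp (b : C(Torus, ℂ)) : IsUnit (toepOp (NormedSpace.exp b)) := by
  -- Units form an open set and `p = b` gives `toepOp 1 = 1`, so some trigonometric polynomial `p`
  -- makes the middle factor invertible.
  have hopen : IsOpen {p : C(Torus, ℂ) | IsUnit (toepOp (NormedSpace.exp (b - p)))} :=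
    Units.isOpen.preimage (continuous_toepOp.comp
      (NormedSpace.exp_continuous.comp (continuous_const.sub continuous_id)))
  obtain ⟨p, hp, hps⟩ := dense_span_fourier.exists_mem_open hopen ⟨b, by
    simp only [Set.mem_ofPred_eq, sub_self, NormedSpace.exp_zero, toepOp_one]
    exact isUnit_one⟩
  obtain ⟨a, ha, c, hc, rfl⟩ := exists_minus_add_plus hp
  have h : NormedSpace.exp b
      = NormedSpace.exp a * (NormedSpace.exp (b - (a + c)) * NormedSpace.exp c) := by
    rw [← NormedSpace.exp_add_of_commute (Commute.all _ _),
      ← NormedSpace.exp_add_of_commute (Commute.all _ _)]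
    congr 1
    ring
  rw [h, toepOp_mul_of_minus (exp_mem_stabilizer ha), toepOp_mul_of_plus _ (exp_mem_stabilizer hc)]
  exact (isUnit_toepOp_of_minus (exp_mem_stabilizer ha) (exp_mem_stabilizer (neg_mem ha))
    (exp_mul_exp_neg a)).mul (IsUnit.mul hps (isUnit_toepOp_of_plus (exp_mem_stabilizer hc)
      (exp_mem_stabilizer (neg_mem hc)) (exp_mul_exp_neg c)))

theorem exp_apply (f : C(Torus, ℂ)) (t : Torus) :
    NormedSpace.exp f t = Complex.exp (f t) := by
  have h := NormedSpace.map_exp (ContinuousMap.evalAlgHom ℂ ℂ t) (continuous_eval_const t) f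
  rw [Complex.exp_eq_exp_ℂ]
  exact h

/-- The logarithm `log |φ| + iα` on `[0, 2π]` has equal values at the endpoints because the winding
number is zero, so it descends to the circle. -/
theorem exists_exp_eq {φ : C(Torus, ℂ)} (hφ : ∀ t, φ t ≠ 0) (hwind : HasWindingNumber φ 0) :
    ∃ b : C(Torus, ℂ), NormedSpace.exp b = φ := by
  obtain ⟨α, hα, hexp, hper⟩ := hwind
  let β : ℝ → ℂ := fun θ => (Real.log ‖φ (θ : Torus)‖ : ℂ) + (α θ : ℂ) * Complex.I
  have hper' : α 0 = α (2 * Real.pi) := by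
    rw [Int.cast_zero, mul_zero] at hper
    linarith
  have hβ : β 0 = β (2 * Real.pi) := by
    simp only [β]
    rw [hper', AddCircle.coe_period]
    simp
  have hcont : ContinuousOn β (Set.Icc 0 (2 * Real.pi)) := by
    have h1 : Continuous fun θ : ℝ => Real.log ‖φ (θ : Torus)‖ :=
      ((φ.continuous.comp (AddCircle.continuous_mk' _)).norm).log fun θ =>
        norm_ne_zero_iff.mpr (hφ _)
    exact (Complex.continuous_ofReal.comp h1).continuousOn.add
      ((Complex.continuous_ofReal.comp_continuousOn hα).mul continuousOn_const)
  refine ⟨⟨AddCircle.liftIco (2 * Real.pi) 0 β, AddCircle.liftIco_zero_continuous hβ hcont⟩, ?_⟩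
  ext t
  obtain ⟨θ, hθ, rfl⟩ := AddCircle.eq_coe_Ico t
  rw [exp_apply, ContinuousMap.coe_mk, AddCircle.liftIco_zero_coe_apply hθ,
    hexp θ (Set.Ico_subset_Icc_self hθ), Complex.exp_add, ← Complex.ofReal_exp,
    Real.exp_log (norm_pos_iff.mpr (hφ _))]

/-! ### Stability of the finite sections. -/

/-- The truncation of a sequence to its first `N` entries. -/
def trunc (N : ℕ) (x : ℕ → ℂ) : EllTwo := ∑ i ∈ Finset.range N, lp.single 2 i (x i)

theorem trunc_apply (N : ℕ) (x : ℕ → ℂ) (j : ℕ) : trunc N x j = if j < N then x j else 0 := by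
  unfold trunc
  rw [lp.coeFn_sum, Finset.sum_apply]
  simp only [lp.coeFn_single, Pi.single_apply, Finset.sum_ite_eq, Finset.mem_range]

theorem norm_trunc_sq (N : ℕ) (x : ℕ → ℂ) :
    ‖trunc N x‖ ^ 2 = ∑ i ∈ Finset.range N, ‖x i‖ ^ 2 := by
  have h := lp.norm_sum_single (p := 2) (by simp) x (Finset.range N)
  simpa [trunc] using h

theorem tendsto_sub_trunc (x : EllTwo) :
    Tendsto (fun N => ‖x - trunc N x‖) atTop (𝓝 0) := by
  have h := (lp.hasSum_single (p := 2) (by simp) x).tendsto_sum_nat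
  have h2 := (tendsto_const_nhds (x := x)).sub h
  rw [sub_self] at h2
  simpa [trunc] using h2.norm

theorem inner_trunc (N : ℕ) (v f : EllTwo) :
    inner ℂ (trunc N v) f = inner ℂ v (trunc N f) := by
  simp only [trunc, sum_inner, inner_sum, lp.inner_single_left, lp.inner_single_right]

theorem norm_sq_add_le (a b : ℂ) : ‖a + b‖ ^ 2 ≤ 2 * ‖a‖ ^ 2 + 2 * ‖b‖ ^ 2 := by
  have h1 := norm_add_le a b
  have h2 := norm_nonneg (a + b)
  nlinarith [sq_nonneg (‖a‖ - ‖b‖)]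

theorem toepOp_trunc (φ : C(Torus, ℂ)) (N : ℕ) (x : ℕ → ℂ) (j : ℕ) :
    toepOp φ (trunc N x) j = ∑ k ∈ Finset.range N, coeff φ ((j : ℤ) - k) * x k := by
  have h := toepOp_hasSum φ (trunc N x) j
  refine h.unique ?_
  convert hasSum_sum_of_ne_finset_zero (s := Finset.range N) ?_ using 1
  · refine Finset.sum_congr rfl fun k hk => ?_
    rw [trunc_apply, if_pos (Finset.mem_range.mp hk), infMatrix, Matrix.of_apply]
  · intro k hk
    rw [trunc_apply, if_neg (by simpa using hk), mul_zero]
  · infer_instance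

/-- Entry `i` of `X` is the pairing of `T(φ) X` with `v = (T(φ)⁻¹)* eᵢ`. The section sees only the
first `N` entries of `v`; the neglected tail tends to 0 and supplies the `ε` term. -/
theorem norm_sq_apply_le_of_isUnit {φ : C(Torus, ℂ)} (hφ : IsUnit (toepOp φ)) (i : ℕ) {ε : ℝ}
    (hε : 0 < ε) : ∃ C : ℝ, 0 ≤ C ∧ ∀ᶠ N in atTop, i < N ∧ ∀ x : ℕ → ℂ,
      ‖x i‖ ^ 2 ≤ C * ‖trunc N (toepOp φ (trunc N x))‖ ^ 2 + ε * ‖trunc N x‖ ^ 2 := by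
  obtain ⟨u, hu⟩ := hφ
  set A : EllTwo →L[ℂ] EllTwo := ↑u⁻¹ with hA
  have hAT : ∀ X, A (toepOp φ X) = X := fun X => by
    have h : A * toepOp φ = 1 := by rw [← hu]; exact u.inv_mul
    exact congrArg (fun B : EllTwo →L[ℂ] EllTwo => B X) h
  set v : EllTwo := ContinuousLinearMap.adjoint A (lp.single 2 i (1 : ℂ)) with hv
  have hlim : Tendsto (fun N => 2 * (‖v - trunc N v‖ * ‖toepOp φ‖) ^ 2) atTop (𝓝 0) := by
    have h := (((tendsto_sub_trunc v).mul_const ‖toepOp φ‖).pow 2).const_mul 2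
    simpa using h
  refine ⟨2 * ‖v‖ ^ 2, by positivity, ?_⟩
  filter_upwards [hlim.eventually_le_const hε, eventually_gt_atTop i] with N hN hi
  refine ⟨hi, fun x => ?_⟩
  set X := trunc N x with hX
  have h1 : x i = inner ℂ v (trunc N (toepOp φ X)) + inner ℂ (v - trunc N v) (toepOp φ X) := by
    rw [inner_sub_left, inner_trunc, add_sub_cancel, hv, ContinuousLinearMap.adjoint_inner_left,
      hAT, lp.inner_single_left, hX, trunc_apply, if_pos hi]
    simp
  rw [h1]
  refine (norm_sq_add_le _ _).trans (add_le_add ?_ ?_)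
  · have h2 := norm_inner_le_norm (𝕜 := ℂ) v (trunc N (toepOp φ X))
    calc 2 * ‖inner ℂ v (trunc N (toepOp φ X))‖ ^ 2
        ≤ 2 * (‖v‖ * ‖trunc N (toepOp φ X)‖) ^ 2 := by gcongr
      _ = _ := by ring
  · have h2 := norm_inner_le_norm (𝕜 := ℂ) (v - trunc N v) (toepOp φ X)
    have h3 := (toepOp φ).le_opNorm X
    calc 2 * ‖inner ℂ (v - trunc N v) (toepOp φ X)‖ ^ 2
        ≤ 2 * (‖v - trunc N v‖ * (‖toepOp φ‖ * ‖X‖)) ^ 2 := by gcongr; exact h2.trans (by gcongr)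
      _ = 2 * (‖v - trunc N v‖ * ‖toepOp φ‖) ^ 2 * ‖X‖ ^ 2 := by ring
      _ ≤ _ := by gcongr

/-- Multiplication by a trigonometric polynomial is a banded matrix of some half-width `m`. -/
theorem exists_coord_mulOp_eq_zero {q : C(Torus, ℂ)}
    (hq : q ∈ Submodule.span ℂ (Set.range (fourier (T := 2 * Real.pi)))) :
    ∃ m : ℕ, ∀ (w : LTwo) (n : ℤ), (∀ k : ℤ, n - m ≤ k → k ≤ n + m → coord k w = 0) →
      coord n (mulOp q w) = 0 := by
  induction hq using Submodule.span_induction with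
  | mem x hx =>
    obtain ⟨k, rfl⟩ := hx
    refine ⟨k.natAbs, fun w n h => ?_⟩
    rw [coord_mulOp_fourier]
    exact h _ (by omega) (by omega)
  | zero => exact ⟨0, fun w n _ => by
      rw [← mulOpL_apply, map_zero, zero_apply, map_zero]⟩
  | add x y _ _ hx hy =>
    obtain ⟨m, hm⟩ := hx
    obtain ⟨m', hm'⟩ := hy
    refine ⟨max m m', fun w n h => ?_⟩
    rw [← mulOpL_apply, map_add, add_apply, map_add, mulOpL_apply, mulOpL_apply,
      hm w n fun k h1 h2 => h k (by push_cast; omega) (by push_cast; omega),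
      hm' w n fun k h1 h2 => h k (by push_cast; omega) (by push_cast; omega), add_zero]
  | smul r x _ hx =>
    obtain ⟨m, hm⟩ := hx
    refine ⟨m, fun w n h => ?_⟩
    rw [← mulOpL_apply, map_smul, smul_apply, map_smul, mulOpL_apply, hm w n h, smul_zero]

theorem sum_norm_coord_sq_le (s : Finset ℕ) (x : LTwo) :
    ∑ n ∈ s, ‖coord n x‖ ^ 2 ≤ ‖x‖ ^ 2 :=
  ((orthonormal_fourier (T := 2 * Real.pi)).comp (fun k : ℕ => (k : ℤ))
    Nat.cast_injective).sum_inner_products_le x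

/-- A trigonometric polynomial `q` near `φ⁻¹` nearly inverts multiplication by `φ`. Being banded, it
reads, at indices at least `m` from the ends, only coordinates that the section retains. -/
theorem exists_sum_middle_le {φ φi : C(Torus, ℂ)} (hφ : φi * φ = 1) {ε : ℝ} (hε : 0 < ε) :
    ∃ (m : ℕ) (C : ℝ), 0 ≤ C ∧ ∀ (N : ℕ) (x : ℕ → ℂ),
      ∑ j ∈ Finset.Ico m (N - m), ‖x j‖ ^ 2
        ≤ C * ‖trunc N (toepOp φ (trunc N x))‖ ^ 2 + ε * ‖trunc N x‖ ^ 2 := by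
  have hopen : IsOpen {q : C(Torus, ℂ) | 2 * ‖mulOpL (1 - q * φ)‖ ^ 2 < ε} :=
    isOpen_lt (by fun_prop) continuous_const
  obtain ⟨q, hq, hqs⟩ := dense_span_fourier.exists_mem_open hopen ⟨φi, by
    simp only [Set.mem_ofPred_eq, hφ, sub_self, map_zero, norm_zero]
    simpa using hε⟩
  obtain ⟨m, hm⟩ := exists_coord_mulOp_eq_zero hq
  refine ⟨m, 2 * ‖mulOp q‖ ^ 2, by positivity, fun N x => ?_⟩
  set X := trunc N x
  set Y := trunc N (toepOp φ X) with hY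
  have hsplit : ∀ j ∈ Finset.Ico m (N - m),
      x j = coord j (mulOp q (synth Y)) + coord j (mulOpL (1 - q * φ) (synth X)) := by
    intro j hj
    rw [Finset.mem_Ico] at hj
    -- On the window `[j - m, j + m] ⊆ [0, N)` the coefficients of `φ * X` and of `Y` agree.
    have h0 : coord j (mulOp q (mulOp φ (synth X) - synth Y)) = 0 := by
      refine hm _ _ fun k h1 h2 => ?_
      lift k to ℕ using by omega
      rw [map_sub, coord_synth_nat, hY, trunc_apply, if_pos (by omega), toepOp_apply, sub_self]
    rw [map_sub, map_sub, sub_eq_zero] at h0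
    rw [map_sub, mulOpL_apply, mulOpL_apply, mulOp_one, mulOp_mul, sub_apply, map_sub,
      ContinuousLinearMap.comp_apply, h0, add_sub_cancel, ContinuousLinearMap.id_apply,
      coord_synth_nat, trunc_apply, if_pos (by omega)]
  calc ∑ j ∈ Finset.Ico m (N - m), ‖x j‖ ^ 2
      ≤ ∑ j ∈ Finset.Ico m (N - m), (2 * ‖coord j (mulOp q (synth Y))‖ ^ 2
          + 2 * ‖coord j (mulOpL (1 - q * φ) (synth X))‖ ^ 2) :=
        Finset.sum_le_sum fun j hj => by
          rw [hsplit j hj]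
          exact norm_sq_add_le _ _
    _ ≤ 2 * ‖mulOp q (synth Y)‖ ^ 2 + 2 * ‖mulOpL (1 - q * φ) (synth X)‖ ^ 2 := by
        rw [Finset.sum_add_distrib, ← Finset.mul_sum, ← Finset.mul_sum]
        gcongr <;> exact sum_norm_coord_sq_le _ _
    _ ≤ 2 * (‖mulOp q‖ * ‖synth Y‖) ^ 2 + 2 * (‖mulOpL (1 - q * φ)‖ * ‖synth X‖) ^ 2 := by
        gcongr <;> exact ContinuousLinearMap.le_opNorm _ _
    _ = 2 * ‖mulOp q‖ ^ 2 * ‖Y‖ ^ 2 + 2 * ‖mulOpL (1 - q * φ)‖ ^ 2 * ‖X‖ ^ 2 := by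
        rw [LinearIsometry.norm_map, LinearIsometry.norm_map]
        ring
    _ ≤ _ := by
        gcongr
        exact le_of_lt hqs

/-- The symbol `z ↦ φ(z⁻¹)`. -/
def reflect (φ : C(Torus, ℂ)) : C(Torus, ℂ) := φ.comp ⟨Neg.neg, continuous_neg⟩

theorem coeff_reflect (φ : C(Torus, ℂ)) (n : ℤ) : coeff (reflect φ) n = coeff φ (-n) := by
  unfold coeff fourierCoeff
  rw [← integral_neg_eq_self]
  refine integral_congr_ae (Eventually.of_forall fun t => ?_)
  simp [reflect, fourier_apply]

theorem exp_reflect (b : C(Torus, ℂ)) :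
    NormedSpace.exp (reflect b) = reflect (NormedSpace.exp b) := by
  ext t
  rw [exp_apply]
  exact (exp_apply b (-t)).symm

theorem norm_trunc_reverse (N : ℕ) (x : ℕ → ℂ) :
    ‖trunc N fun k => x (N - 1 - k)‖ ^ 2 = ‖trunc N x‖ ^ 2 := by
  rw [norm_trunc_sq, norm_trunc_sq]
  exact Finset.sum_range_reflect (fun k => ‖x k‖ ^ 2) N

/-- Reversing rows and columns transposes a finite Toeplitz matrix, which is the same as replacing
`φ(z)` by `φ(z⁻¹)`. -/
theorem toepOp_reflect_trunc (φ : C(Torus, ℂ)) (N : ℕ) (x : ℕ → ℂ) {j : ℕ} (hj : j < N) :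
    toepOp (reflect φ) (trunc N fun k => x (N - 1 - k)) j
      = toepOp φ (trunc N x) (N - 1 - j) := by
  rw [toepOp_trunc, toepOp_trunc, ← Finset.sum_range_reflect]
  refine Finset.sum_congr rfl fun k hk => ?_
  rw [Finset.mem_range] at hk
  rw [coeff_reflect, show N - 1 - (N - 1 - k) = k by omega]
  congr 2
  omega

theorem norm_trunc_toepOp_reflect (φ : C(Torus, ℂ)) (N : ℕ) (x : ℕ → ℂ) :
    ‖trunc N (toepOp (reflect φ) (trunc N fun k => x (N - 1 - k)))‖ ^ 2
      = ‖trunc N (toepOp φ (trunc N x))‖ ^ 2 := by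
  rw [← norm_trunc_reverse N (toepOp φ (trunc N x)), norm_trunc_sq, norm_trunc_sq]
  refine Finset.sum_congr rfl fun k hk => ?_
  rw [toepOp_reflect_trunc φ N x (Finset.mem_range.mp hk)]

/-- Stability of the finite sections. -/
theorem exists_norm_trunc_sq_le (b : C(Torus, ℂ)) : ∃ K : ℝ, 0 ≤ K ∧ ∀ᶠ N in atTop,
    ∀ x : ℕ → ℂ, ‖trunc N x‖ ^ 2
      ≤ K * ‖trunc N (toepOp (NormedSpace.exp b) (trunc N x))‖ ^ 2 := by
  set φ := NormedSpace.exp b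
  have hinv : NormedSpace.exp (-b) * φ = 1 := (mul_comm _ _).trans (exp_mul_exp_neg b)
  have hu : IsUnit (toepOp φ) := isUnit_toepOp_exp b
  have hr : IsUnit (toepOp (reflect φ)) := by
    rw [← exp_reflect]
    exact isUnit_toepOp_exp _
  obtain ⟨m, C, hC, hmid⟩ := exists_sum_middle_le hinv (ε := 1 / 4) (by norm_num)
  -- Each of the `m` entries at an end costs this much, so an end costs at most `1/8`; `m + 1` keeps
  -- the denominator positive when `m = 0`.
  have hε : (0 : ℝ) < 1 / (8 * (m + 1)) := by positivity
  choose A hA hA' using fun i => norm_sq_apply_le_of_isUnit hu i hε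
  choose B hB hB' using fun i => norm_sq_apply_le_of_isUnit hr i hε
  have hKA : 0 ≤ ∑ i ∈ Finset.range m, A i := Finset.sum_nonneg fun i _ => hA i
  have hKB : 0 ≤ ∑ i ∈ Finset.range m, B i := Finset.sum_nonneg fun i _ => hB i
  refine ⟨2 * (∑ i ∈ Finset.range m, A i + C + ∑ i ∈ Finset.range m, B i), by positivity, ?_⟩
  filter_upwards [(Finset.eventually_all (Finset.range m)).mpr fun i _ => hA' i,
    (Finset.eventually_all (Finset.range m)).mpr fun i _ => hB' i,
    eventually_ge_atTop (2 * m)] with N h1 h2 hN x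
  set E := ‖trunc N x‖ ^ 2 with hE
  set F := ‖trunc N (toepOp φ (trunc N x))‖ ^ 2
  have hE0 : 0 ≤ E := by positivity
  have hmε : (m : ℝ) * (1 / (8 * (m + 1))) ≤ 1 / 8 := by
    rw [mul_one_div, div_le_div_iff₀ (by positivity) (by norm_num)]
    linarith
  have hmε' : (m : ℝ) * (1 / (8 * (m + 1)) * E) ≤ 1 / 8 * E := by
    rw [← mul_assoc]
    gcongr
  have e1 : ∑ i ∈ Finset.range m, ‖x i‖ ^ 2 ≤ (∑ i ∈ Finset.range m, A i) * F + 1 / 8 * E := by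
    refine (Finset.sum_le_sum fun i hi => (h1 i hi).2 x).trans ?_
    rw [Finset.sum_add_distrib, ← Finset.sum_mul, Finset.sum_const, Finset.card_range,
      nsmul_eq_mul]
    gcongr
  have e2 : ∑ i ∈ Finset.range m, ‖x (N - 1 - i)‖ ^ 2
      ≤ (∑ i ∈ Finset.range m, B i) * F + 1 / 8 * E := by
    refine (Finset.sum_le_sum fun i hi => (h2 i hi).2 fun k => x (N - 1 - k)).trans ?_
    rw [norm_trunc_reverse, norm_trunc_toepOp_reflect,
      Finset.sum_add_distrib, ← Finset.sum_mul, Finset.sum_const, Finset.card_range, nsmul_eq_mul]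
    gcongr
  have e3 := hmid N x
  -- Since `2 * m ≤ N`, the two ends and the middle tile `{0, …, N-1}`.
  have hsum : E = ∑ i ∈ Finset.range m, ‖x i‖ ^ 2 + ∑ j ∈ Finset.Ico m (N - m), ‖x j‖ ^ 2
      + ∑ i ∈ Finset.range m, ‖x (N - 1 - i)‖ ^ 2 := by
    have hlast : ∑ i ∈ Finset.range m, ‖x (N - 1 - i)‖ ^ 2
        = ∑ j ∈ Finset.Ico (N - m) N, ‖x j‖ ^ 2 := by
      rw [Finset.sum_Ico_eq_sum_range, show N - (N - m) = m by omega, ← Finset.sum_range_reflect]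
      refine Finset.sum_congr rfl fun k hk => ?_
      rw [Finset.mem_range] at hk
      congr 3
      omega
    rw [hE, norm_trunc_sq, hlast, Finset.sum_range_add_sum_Ico _ (by omega),
      Finset.sum_range_add_sum_Ico _ (by omega)]
  -- The error terms add up to `(1/8 + 1/4 + 1/8) * E = E / 2`; absorbing them on the left produces
  -- the factor 2 in the constant.
  linarith

theorem norm_trunc_le (N : ℕ) (f : EllTwo) : ‖trunc N f‖ ^ 2 ≤ ‖f‖ ^ 2 := by
  rw [norm_trunc_sq]
  have h := lp.sum_rpow_le_norm_rpow (p := 2) (by simp) f (Finset.range N)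
  simpa using h

theorem trunc_sub (N : ℕ) (x y : ℕ → ℂ) :
    trunc N (fun k => x k - y k) = trunc N x - trunc N y := by
  ext j
  rw [lp.coeFn_sub, Pi.sub_apply, trunc_apply, trunc_apply, trunc_apply]
  split_ifs <;> simp

/-! ### From stability to finite matrices and convergence. -/

/-- Extension of a finite vector by zero. -/
def extendZero {N : ℕ} (x : Fin N → ℂ) : ℕ → ℂ := fun k => if h : k < N then x ⟨k, h⟩ else 0

theorem extendZero_val {N : ℕ} (x : Fin N → ℂ) (i : Fin N) : extendZero x i = x i := by
  simp [extendZero]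

theorem finMatrix_mulVec (φ : C(Torus, ℂ)) {N : ℕ} (x : Fin N → ℂ) (j : Fin N) :
    (finMatrix N φ).mulVec x j = toepOp φ (trunc N (extendZero x)) j := by
  rw [toepOp_trunc, ← Fin.sum_univ_eq_sum_range
    (fun k => coeff φ (((j : ℕ) : ℤ) - k) * extendZero x k)]
  simp only [extendZero_val]
  rfl

theorem isUnit_finMatrix {φ : C(Torus, ℂ)} {N : ℕ} {K : ℝ} (h : ∀ x : ℕ → ℂ,
    ‖trunc N x‖ ^ 2 ≤ K * ‖trunc N (toepOp φ (trunc N x))‖ ^ 2) : IsUnit (finMatrix N φ) := by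
  rw [← Matrix.mulVec_injective_iff_isUnit]
  refine (injective_iff_map_eq_zero (Matrix.mulVecLin (finMatrix N φ))).mpr fun x hx => ?_
  have h0 : ‖trunc N (toepOp φ (trunc N (extendZero x)))‖ ^ 2 = 0 := by
    rw [norm_trunc_sq]
    refine Finset.sum_eq_zero fun j hj => ?_
    have h1 := finMatrix_mulVec φ x ⟨j, Finset.mem_range.mp hj⟩
    rw [Matrix.mulVecLin_apply] at hx
    rw [hx] at h1
    rw [← h1]
    simp
  have h2 := h (extendZero x)
  rw [h0, mul_zero, norm_trunc_sq] at h2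
  have h3 := (Finset.sum_eq_zero_iff_of_nonneg fun i _ => by positivity).mp
    (le_antisymm h2 (Finset.sum_nonneg fun i _ => by positivity))
  ext i
  have h4 := h3 i (Finset.mem_range.mpr i.2)
  rw [extendZero_val] at h4
  simpa using h4

theorem finMatrix_mulVec_eZero (f : Torus → ℂ) {N : ℕ} (j : Fin N) :
    (finMatrix N f).mulVec (eZero N) j = coeff f j := by
  have hN : 0 < N := j.pos
  rw [Matrix.mulVec, dotProduct, Finset.sum_eq_single ⟨0, hN⟩]
  · simp [finMatrix, eZero]
  · intro i _ hi
    have : (i : ℕ) ≠ 0 := fun h => hi (Fin.ext h)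
    simp [eZero, this]
  · simp

theorem eZero_dotProduct {N : ℕ} (hN : 0 < N) (z : Fin N → ℂ) :
    eZero N ⬝ᵥ z = extendZero z 0 := by
  rw [dotProduct, Finset.sum_eq_single ⟨0, hN⟩]
  · simp [eZero, extendZero, hN]
  · intro i _ hi
    have : (i : ℕ) ≠ 0 := fun h => hi (Fin.ext h)
    simp [eZero, this]
  · simp

theorem toepCol_apply (ψ : LTwo) (j : ℕ) : toepCol ψ j = coeff ψ j := by
  change coeff ψ ((j : ℤ) - (0 : ℕ)) = coeff ψ j
  simp

theorem toepCol_eq (ψ : LTwo) :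
    toepCol ψ = ContinuousLinearMap.adjoint synth.toContinuousLinearMap ψ := by
  ext j
  rw [toepCol_apply, adjoint_synth_apply, coord_eq_coeff]

theorem toepOp_inverse_apply {φ : C(Torus, ℂ)} (hφ : IsUnit (toepOp φ)) (y : EllTwo) :
    toepOp φ (Ring.inverse (toepOp φ) y) = y :=
  congrArg (fun B : EllTwo →L[ℂ] EllTwo => B y) (Ring.mul_inverse_cancel _ hφ)

/-- On the first `N` rows the finite and infinite systems have the same right-hand side. Hence the
section applied to the difference of their solutions is the truncation of `T(φ)` applied to the tail
`X - trunc N X`, and stability applies. -/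
theorem norm_finConst_sub_limConst_sq_le {φ : C(Torus, ℂ)} (hφ : IsUnit (toepOp φ)) (ψ : LTwo)
    {N : ℕ} (hN : 0 < N) {K : ℝ} (hK : 0 ≤ K) (h : ∀ x : ℕ → ℂ,
      ‖trunc N x‖ ^ 2 ≤ K * ‖trunc N (toepOp φ (trunc N x))‖ ^ 2) :
    ‖finConst N φ ψ - limConst φ ψ‖ ^ 2 ≤ K * (‖toepOp φ‖ *
      ‖Ring.inverse (toepOp φ) (toepCol ψ) - trunc N (Ring.inverse (toepOp φ) (toepCol ψ))‖) ^ 2 := by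
  -- Needed because `⁻¹` of a singular matrix is 0 by convention.
  have hunit := isUnit_finMatrix h
  set X := Ring.inverse (toepOp φ) (toepCol ψ) with hX
  set z := (finMatrix N φ)⁻¹.mulVec ((finMatrix N ψ).mulVec (eZero N)) with hz
  have hTz : (finMatrix N φ).mulVec z = (finMatrix N ψ).mulVec (eZero N) := by
    rw [hz, Matrix.mulVec_mulVec,
      Matrix.mul_nonsing_inv _ ((Matrix.isUnit_iff_isUnit_det _).mp hunit), Matrix.one_mulVec]
  have hfin : finConst N φ ψ = extendZero z 0 := eZero_dotProduct hN z
  have hlim : limConst φ ψ = X 0 := rfl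
  have hT : ∀ j < N, toepOp φ (trunc N fun k => extendZero z k - X k) j
      = toepOp φ (X - trunc N X) j := by
    intro j hj
    have h1 := finMatrix_mulVec φ z ⟨j, hj⟩
    rw [hTz, finMatrix_mulVec_eZero] at h1
    rw [trunc_sub, map_sub, map_sub, lp.coeFn_sub, lp.coeFn_sub, Pi.sub_apply, Pi.sub_apply,
      hX, toepOp_inverse_apply hφ, toepCol_apply]
    exact congrArg (· - _) h1.symm
  rw [hfin, hlim]
  calc ‖extendZero z 0 - X 0‖ ^ 2
      ≤ ‖trunc N fun k => extendZero z k - X k‖ ^ 2 := by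
        rw [norm_trunc_sq]
        exact Finset.single_le_sum (f := fun k => ‖extendZero z k - X k‖ ^ 2)
          (fun i _ => by positivity) (Finset.mem_range.mpr hN)
    _ ≤ K * ‖trunc N (toepOp φ (trunc N fun k => extendZero z k - X k))‖ ^ 2 := h _
    _ = K * ‖trunc N (toepOp φ (X - trunc N X))‖ ^ 2 := by
        rw [norm_trunc_sq, norm_trunc_sq]
        congr 1
        exact Finset.sum_congr rfl fun j hj => by rw [hT j (Finset.mem_range.mp hj)]
    _ ≤ K * ‖toepOp φ (X - trunc N X)‖ ^ 2 := by
        gcongr K * ?_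
        exact norm_trunc_le _ _
    _ ≤ _ := by
        gcongr
        exact ContinuousLinearMap.le_opNorm _ _

/-! ### The Wiener–Hopf formula and the limit. -/

/-- The pointwise inverse of a nonvanishing symbol. -/
def invSymbol (f : C(Torus, ℂ)) (hf : ∀ t, f t ≠ 0) : C(Torus, ℂ) :=
  ⟨fun t => (f t)⁻¹, f.continuous.inv₀ hf⟩

theorem mul_invSymbol (f : C(Torus, ℂ)) (hf : ∀ t, f t ≠ 0) : f * invSymbol f hf = 1 := by
  ext t
  exact mul_inv_cancel₀ (hf t)

theorem mem_plusAlgebra {f : C(Torus, ℂ)} (hf : IsHardyPlus f) : f ∈ plusAlgebra :=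
  mem_stabilizer_of_coeff fun n hn k hk => hf.2 _ (by
    simp only [Set.mem_ofPred_eq] at hn hk; omega)

theorem mem_minusAlgebra {f : C(Torus, ℂ)} (hf : IsHardyMinus f) : f ∈ minusAlgebra :=
  mem_stabilizer_of_coeff fun n hn k hk => hf.2 _ (by
    simp only [Set.mem_ofPred_eq] at hn hk; omega)

/-- Row 0 of the matrix has entries `f₋ₖ`, which vanish for `k > 0`. -/
theorem toepOp_apply_zero_of_plus {f : C(Torus, ℂ)} (hf : IsHardyPlus f) (x : EllTwo) :
    toepOp f x 0 = coeff f 0 * x 0 := by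
  refine (toepOp_hasSum f x 0).unique ?_
  convert hasSum_single 0 fun k hk => ?_ using 1
  · simp [infMatrix]
  · rw [infMatrix, Matrix.of_apply, hf.2 _ (by simp; omega), zero_mul]

theorem coeff_zero_ne_zero_and_limConst_eq {φ φm φp : C(Torus, ℂ)} (h : IsWienerHopf φ φm φp)
    (ψ : LTwo) : coeff φp 0 ≠ 0 ∧
      limConst φ ψ = coeff (fun t => (φm t)⁻¹ * ψ t) 0 / coeff φp 0 := by
  set pi := invSymbol φp h.plus_ne_zero
  set mi := invSymbol φm h.minus_ne_zero
  have hp := mem_plusAlgebra h.plus_mem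
  have hpi : pi ∈ plusAlgebra := mem_plusAlgebra h.plus_inv_mem
  have hm := mem_minusAlgebra h.minus_mem
  have hmi : mi ∈ minusAlgebra := mem_minusAlgebra h.minus_inv_mem
  have hpp : φp * pi = 1 := mul_invSymbol _ _
  have hmm : φm * mi = 1 := mul_invSymbol _ _
  have hφ : φ = φm * φp := ContinuousMap.ext h.factor
  have hunit : IsUnit (toepOp φ) := by
    rw [hφ, toepOp_mul_of_minus hm]
    exact (isUnit_toepOp_of_minus hm hmi hmm).mul (isUnit_toepOp_of_plus hp hpi hpp)
  obtain ⟨X, hX⟩ : ∃ X, X = Ring.inverse (toepOp φ) (toepCol ψ) := ⟨_, rfl⟩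
  have h1 : toepOp φm (toepOp φp X) = toepCol ψ := by
    rw [← mul_apply_eq_comp, ← toepOp_mul_of_minus hm, ← hφ, hX, toepOp_inverse_apply hunit]
  have h2 : toepOp φp X = toepOp mi (toepCol ψ) := by
    rw [← h1, ← mul_apply_eq_comp, ← toepOp_mul_of_minus hmi, mul_comm, hmm, toepOp_one,
      one_apply_eq_self]
  -- Replacing `ψ` by its projection to `H²` does not change coordinate 0, because multiplication by
  -- `φm⁻¹` keeps negative frequencies negative.
  have h3 : coeff φp 0 * X 0 = coeff (fun t => (φm t)⁻¹ * ψ t) 0 := by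
    rw [← toepOp_apply_zero_of_plus h.plus_mem, h2, toepOp_apply, toepCol_eq]
    exact (adjoint_mulOp_synth_adjoint hmi ψ le_rfl).trans (coord_mulOp mi 0 ψ)
  -- Coordinate 0 of `T(φ₊) T(φ₊⁻¹) e₀ = e₀` writes 1 as a multiple of `[φ₊]₀`.
  have h4 : coeff φp 0 ≠ 0 := fun h0 => by
    have h5 := toepOp_apply_zero_of_plus h.plus_mem (toepOp pi (lp.single 2 0 (1 : ℂ)))
    rw [← mul_apply_eq_comp, ← toepOp_mul_of_plus _ hpi, hpp, toepOp_one, one_apply_eq_self, h0,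
      zero_mul] at h5
    simp at h5
  refine ⟨h4, ?_⟩
  rw [eq_div_iff h4, ← h3, mul_comm, hX]
  rfl

theorem tendsto_finConst (b : C(Torus, ℂ)) (ψ : LTwo) :
    Tendsto (fun N => finConst N (NormedSpace.exp b : C(Torus, ℂ)) ψ) atTop
      (𝓝 (limConst (NormedSpace.exp b) ψ)) := by
  obtain ⟨K, hK, hstab⟩ := exists_norm_trunc_sq_le b
  set X := Ring.inverse (toepOp (NormedSpace.exp b)) (toepCol ψ)
  have hlim : Tendsto (fun N => √(K * (‖toepOp (NormedSpace.exp b)‖ * ‖X - trunc N X‖) ^ 2))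
      atTop (𝓝 0) := by
    have h := ((((tendsto_sub_trunc X).const_mul ‖toepOp (NormedSpace.exp b)‖).pow 2).const_mul
      K).sqrt
    simpa using h
  rw [tendsto_iff_norm_sub_tendsto_zero]
  refine squeeze_zero' (Eventually.of_forall fun _ => norm_nonneg _) ?_ hlim
  filter_upwards [hstab, eventually_gt_atTop 0] with N hN hpos
  exact Real.le_sqrt_of_sq_le
    (norm_finConst_sub_limConst_sq_le (isUnit_toepOp_exp b) ψ hpos hK hN)

end BorderedToeplitz

end

theorem proposition3p2 (ψ : BorderedToeplitz.LTwo) (φ : C(BorderedToeplitz.Torus, ℂ))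
    (hφ : ∀ t, φ t ≠ 0) (hwind : BorderedToeplitz.HasWindingNumber φ 0) :
    IsUnit (BorderedToeplitz.toepOp φ) ∧
    (∀ᶠ N : ℕ in Filter.atTop, IsUnit (BorderedToeplitz.finMatrix N φ)) ∧
    Filter.Tendsto (fun N : ℕ => BorderedToeplitz.finConst N φ ψ) Filter.atTop
      (nhds (BorderedToeplitz.limConst φ ψ)) ∧
    ∀ φm φp : C(BorderedToeplitz.Torus, ℂ), BorderedToeplitz.IsWienerHopf φ φm φp →
      BorderedToeplitz.coeff φp 0 ≠ 0 ∧
      BorderedToeplitz.limConst φ ψ =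
        BorderedToeplitz.coeff (fun t => (φm t)⁻¹ * ψ t) 0 / BorderedToeplitz.coeff φp 0 := by
  obtain ⟨b, rfl⟩ := BorderedToeplitz.exists_exp_eq hφ hwind
  obtain ⟨K, _, hstab⟩ := BorderedToeplitz.exists_norm_trunc_sq_le b
  exact ⟨BorderedToeplitz.isUnit_toepOp_exp b,
    hstab.mono fun N hN => BorderedToeplitz.isUnit_finMatrix hN,
    BorderedToeplitz.tendsto_finConst b ψ,
    fun φm φp h => BorderedToeplitz.coeff_zero_ne_zero_and_limConst_eq h ψ⟩
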